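/- Let $A$ be a set of actions. Star expressions over $A$ are given by $e ::= 0 \mid 1 \mid a \mid e+e \mid e\cdot e \mid e^*$ ($a\in A$); $e{\downarrow}$ ("$e$ permits immediate termination") is defined inductively by: $1{\downarrow}$; $(e^*){\downarrow}$; $(e+f){\downarrow}$ if $e{\downarrow}$ or $f{\downarrow}$; $(e\cdot f){\downarrow}$ if $e{\downarrow}$ and $f{\downarrow}$. Proof systems are Hilbert-style systems whose formulas are equations between star expressions. $\mathsf{Mil}^-$ has the rules of equational logic (reflexivity, symmetry, transitivity, filling a one-hole context) and the axioms $(e+f)+g=e+(f+g)$, $e+0=e$, $e+f=f+e$, $e+e=e$, $(e\cdot f)\cdot g=e\cdot(f\cdot g)$, $(e+f)\cdot g=e\cdot g+f\cdot g$, $1\cdot e=e$, $e\cdot 1=e$, $0\cdot e=0$, $e^*=1+e\cdot e^*$, $e^*=(1+e)^*$. Milner's system $\mathsf{Mil}$ is $\mathsf{Mil}^-$ plus the rule $\mathrm{RSP}^*$: from $e=f\cdot e+g$ infer $e=f^*\cdot g$, provided that not $f{\downarrow}$. A 1-chart $\underline{\mathcal C}$ consists of a finite vertex set $V$, a start vertex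 $v_s\in V$, labeled transitions in $V\times(A\cup\{\mathbf 1\})\times V$ (where $\mathbf 1\notin A$ is the empty-step label), and a set of immediately terminating vertices. It is weakly guarded if it has no cycle of $\mathbf 1$-transitions. A loop 1-chart is a 1-chart with an infinite path from its start vertex, in which every infinite path from the start vertex returns to it after a positive number of steps, and in which only the start vertex may terminate immediately. A nonempty set $U$ of transitions from a vertex $v$ induces the sub-1-chart formed by all vertices and transitions on paths that start with a transition in $U$ and continue until $v$ is reached again; its body consists of its vertices other than $v$. A multi-step loop elimination removes the entry sets $U_1,\dots,U_n$ ($n\ge 1$) of induced loop sub-1-charts, where the $U_i$ are pairwise disjoint and no start vertex of one of these sub-1-charts is in the body of another one, and then removes all unreachable vertices and transitions. $\underline{\mathcal C}$ is a guarded LLEE-1-chart if some finite sequence of multi-step loop eliminations leads from $\underline{\mathcal C}$ to a 1-chart without infinite path such that all removed entry transitions have labels in $A$, and no removed entry transition departs from a vertex in the body of a previously eliminated loop sub-1-chart. For a proof system $\mathcal S$ extending $\mathsf{Mil}^-$, a function $s$ from the vertices of $\underline{\mathcal C}$ to star expressions is an $\mathcal S$-provable solution if at every vertex $v$ with outgoing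 transitions $v\to^{\underline a_i}v_i$ ($i=1,\dots,n$) the equation $s(v)=\tau(v)+\sum_{i=1}^n\underline a_i\cdot s(v_i)$ is derivable in $\mathcal S$, where $\tau(v)$ is $1$ if $v$ terminates immediately and $0$ otherwise, and the label $\mathbf 1$ is read as the expression $1$. An LLEE-witnessed coinductive proof over $\mathcal S$ of $e=f$ is a weakly guarded, guarded LLEE-1-chart together with a labeling of its vertices by equations, such that the left-hand sides as well as the right-hand sides of these equations form $\mathcal S$-provable solutions, and such that the start vertex is labeled by $e=f$. The system $\mathsf{cMil}_1$ is $\mathsf{Mil}^-$ plus the rule $\mathrm{LCoProof}_1$: from a premise $h=k$ infer $e=f$, provided that there is an LLEE-witnessed coinductive proof of $e=f$ over $\mathsf{Mil}^-+\{h=k\}$ (the extension of $\mathsf{Mil}^-$ by the additional axiom $h=k$). Derivations are prooftrees of equations whose inner nodes carry rule names; coinductive proofs occur only in the side condition of $\mathrm{LCoProof}_1$, and are not part of derivations. **Theorem.** Every theorem of $\mathsf{Mil}$ is a theorem of $\mathsf{cMil}_1$. Moreover, every instance of $\mathrm{RSP}^*$ is, with the same premise and the same conclusion, an instance of $\mathrm{LCoProof}_1$,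 and every derivation in $\mathsf{Mil}$ is transformed into a derivation in $\mathsf{cMil}_1$ with the same conclusion (and from the same assumptions, if any) by replacing every instance of $\mathrm{RSP}^*$ in it by the instance of $\mathrm{LCoProof}_1$ with the same premise and conclusion. This transformation is effective: on prooftrees written as words, for any numbering of the actions, it is carried out by a computable function. -/

import Mathlib

namespace Milner

universe u

/-! ### Star expressions -/

/-- Star expressions over actions in `A`. -/
inductive StExp (A : Type u) : Type u
  | zero : StExp A
  | one : StExp A
  | act (a : A) : StExp A
  | add (e f : StExp A) : StExp A
  | mul (e f : StExp A) : StExp A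
  | star (e : StExp A) : StExp A

/-- Formal equations `lhs = rhs` between star expressions. -/
@[ext]
structure Equation (A : Type u) : Type u where
  lhs : StExp A
  rhs : StExp A

namespace StExp

variable {A : Type u}

/-- `e↓`: the star expression `e` permits immediate termination. -/
inductive Terminates : StExp A → Prop
  | one : Terminates one
  | add_left {e f : StExp A} : Terminates e → Terminates (add e f)
  | add_right {e f : StExp A} : Terminates f → Terminates (add e f)
  | mul {e f : StExp A} : Terminates e → Terminates f → Terminates (mul e f)
  | star {e : StExp A} : Terminates (star e)

/-- Sum expressions: `0` for the empty list, and `((e₁ + e₂) + ⋯) + eₙ` otherwise. -/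
def sum : List (StExp A) → StExp A
  | [] => zero
  | e :: es => es.foldl add e

end StExp

/-- One-hole star expression contexts. -/
inductive Ctx (A : Type u) : Type u
  | hole : Ctx A
  | addLeft (C : Ctx A) (f : StExp A) : Ctx A
  | addRight (e : StExp A) (C : Ctx A) : Ctx A
  | mulLeft (C : Ctx A) (f : StExp A) : Ctx A
  | mulRight (e : StExp A) (C : Ctx A) : Ctx A
  | star (C : Ctx A) : Ctx A

/-- `C.fill e` is the result `C[e]` of filling the hole of the context `C` with `e`. -/
def Ctx.fill {A : Type u} : Ctx A → StExp A → StExp A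
  | hole, e => e
  | addLeft C f, e => StExp.add (C.fill e) f
  | addRight g C, e => StExp.add g (C.fill e)
  | mulLeft C f, e => StExp.mul (C.fill e) f
  | mulRight g C, e => StExp.mul g (C.fill e)
  | star C, e => StExp.star (C.fill e)

/-! ### Equation-based proof systems and their derivations -/

/-- Names of rules. -/
inductive RuleName : Type
  | refl : RuleName
  | symm : RuleName
  | trans : RuleName
  | cxt : RuleName
  | rspStar : RuleName
  | lcoProof (n : ℕ) : RuleName

/-- An inference: a list of premises together with a conclusion. -/
abbrev Inference (A : Type u) : Type u := List (Equation A) × Equation A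

/-- A Hilbert-style proof system whose formulas are equations between star expressions. It is given
by its axioms, and by the instances of each of its rules (a rule that is not part of the system has
no instances). -/
structure ProofSystem (A : Type u) : Type u where
  axioms : Set (Equation A)
  rule : RuleName → Set (Inference A)

/-- Prooftrees: leaves are assumptions or axioms; an inner node carries the name of the rule that is
applied, the `n` immediate subtrees, and the conclusion. -/
inductive ProofTree (A : Type u) : Type u
  | assm (E : Equation A) : ProofTree A
  | ax (E : Equation A) : ProofTree A
  | node (r : RuleName) (n : ℕ) (sub : Fin n → ProofTree A) (E : Equation A) : ProofTree A

namespace ProofTree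

variable {A : Type u}

/-- The conclusion of a prooftree. -/
def concl : ProofTree A → Equation A
  | assm E => E
  | ax E => E
  | node _ _ _ E => E

/-- `D.IsDerivation S Δ`: the prooftree `D` is a derivation in the proof system `S` with all of its
assumptions in `Δ`. -/
def IsDerivation (S : ProofSystem A) (Δ : Set (Equation A)) : ProofTree A → Prop
  | assm E => E ∈ Δ
  | ax E => E ∈ S.axioms
  | node r _ sub E =>
      (∀ i, (sub i).IsDerivation S Δ) ∧ (List.ofFn fun i => (sub i).concl, E) ∈ S.rule r

end ProofTree

namespace ProofSystem

variable {A : Type u}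

/-- `e = f` is derivable in (a theorem of) `S`: it is the conclusion of a derivation in `S` without
assumptions. -/
def Derivable (S : ProofSystem A) (e f : StExp A) : Prop :=
  ∃ D : ProofTree A, D.IsDerivation S ∅ ∧ D.concl = ⟨e, f⟩

/-- `S₁` is theorem-subsumed by `S₂`. -/
def ThmSubsumedBy (S₁ S₂ : ProofSystem A) : Prop :=
  ∀ e f : StExp A, S₁.Derivable e f → S₂.Derivable e f

/-- The system `S + Γ` with the equations in `Γ` as additional axioms. -/
def addAxioms (S : ProofSystem A) (Γ : Set (Equation A)) : ProofSystem A where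
  axioms := S.axioms ∪ Γ
  rule := S.rule

/-- The system `S + R` with the rule `R`, named `r` and given by its instances, added. -/
def addRule (S : ProofSystem A) (r : RuleName) (R : Set (Inference A)) : ProofSystem A where
  axioms := S.axioms
  rule r' := S.rule r' ∪ {ι | r' = r ∧ ι ∈ R}

end ProofSystem

section Systems

variable (A : Type u)

/-- The instances of the rules of equational logic. -/
inductive ELRule : RuleName → List (Equation A) → Equation A → Prop
  | refl (e : StExp A) : ELRule .refl [] ⟨e, e⟩
  | symm (e f : StExp A) : ELRule .symm [⟨e, f⟩] ⟨f, e⟩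
  | trans (e f g : StExp A) : ELRule .trans [⟨e, f⟩, ⟨f, g⟩] ⟨e, g⟩
  | cxt (C : Ctx A) (e f : StExp A) : ELRule .cxt [⟨e, f⟩] ⟨C.fill e, C.fill f⟩

open StExp in
/-- The axioms of the purely equational part of Milner's system. -/
inductive MilAxiom : Equation A → Prop
  | assocAdd (e f g : StExp A) : MilAxiom ⟨add (add e f) g, add e (add f g)⟩
  | neutralAdd (e : StExp A) : MilAxiom ⟨add e zero, e⟩
  | commAdd (e f : StExp A) : MilAxiom ⟨add e f, add f e⟩
  | idempotAdd (e : StExp A) : MilAxiom ⟨add e e, e⟩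
  | assocMul (e f g : StExp A) : MilAxiom ⟨mul (mul e f) g, mul e (mul f g)⟩
  | rDistr (e f g : StExp A) : MilAxiom ⟨mul (add e f) g, add (mul e g) (mul f g)⟩
  | idLeftMul (e : StExp A) : MilAxiom ⟨mul one e, e⟩
  | idRightMul (e : StExp A) : MilAxiom ⟨mul e one, e⟩
  | deadlock (e : StExp A) : MilAxiom ⟨mul zero e, zero⟩
  | recStar (e : StExp A) : MilAxiom ⟨star e, add one (mul e (star e))⟩
  | trmBodyStar (e : StExp A) : MilAxiom ⟨star e, star (add one e)⟩

/-- The purely equational part `Mil⁻` of Milner's system. -/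
def milMinus : ProofSystem A where
  axioms := {E | MilAxiom A E}
  rule r := {ι | ELRule A r ι.1 ι.2}

open StExp in
/-- The instances of the rule `RSP*`: from `e = f·e + g` infer `e = f*·g`, if not `f↓`. -/
inductive RSPStar : List (Equation A) → Equation A → Prop
  | intro (e f g : StExp A) (hf : ¬ f.Terminates) :
      RSPStar [⟨e, add (mul f e) g⟩] ⟨e, mul (star f) g⟩

/-- The set of instances of the rule `RSP*`. -/
def rspStarRule : Set (Inference A) := {ι | RSPStar A ι.1 ι.2}

/-- Milner's system `Mil = Mil⁻ + RSP*`. -/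
def mil : ProofSystem A := (milMinus A).addRule .rspStar (rspStarRule A)

end Systems

/-! ### 1-charts -/

/-- Transitions `(v, l, w)` from `v` to `w`. The label `some a` is the proper action `a`, and the
label `none` is the empty-step label `1`. -/
abbrev Transition (A : Type u) (V : Type) : Type u := V × Option A × V

/-- 1-charts with vertices from the type `V`. -/
structure OneChart (A : Type u) (V : Type) : Type u where
  verts : Set V
  finite_verts : verts.Finite
  start : V
  start_mem : start ∈ verts
  trans : Set (Transition A V)
  trans_mem : ∀ τ ∈ trans, τ.1 ∈ verts ∧ τ.2.2 ∈ verts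
  term : Set V
  term_subset : term ⊆ verts

namespace OneChart

variable {A : Type u} {V : Type}

/-- `π` is an infinite path in `C`. -/
def IsInfinitePath (C : OneChart A V) (π : ℕ → V) : Prop :=
  ∀ i, ∃ l, (π i, l, π (i + 1)) ∈ C.trans

/-- `C` contains no cycle of 1-transitions. -/
def WeaklyGuarded (C : OneChart A V) : Prop :=
  ∀ v, ¬ Relation.TransGen (fun x y => (x, none, y) ∈ C.trans) v v

/-- Loop 1-charts, by the three conditions (L1), (L2), (L3). -/
structure IsLoop (C : OneChart A V) : Prop where
  exists_path : ∃ π, C.IsInfinitePath π ∧ π 0 = C.start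
  returns : ∀ π, C.IsInfinitePath π → π 0 = C.start → ∃ i, 0 < i ∧ π i = C.start
  term_subset_start : C.term ⊆ {C.start}

/-- A vertex `v` of `C` with a nonempty set of transitions of `C` from `v`. -/
structure EntrySet (C : OneChart A V) : Type u where
  vertex : V
  vertex_mem : vertex ∈ C.verts
  entries : Set (Transition A V)
  entries_nonempty : entries.Nonempty
  entries_subset : entries ⊆ C.trans
  entries_source : ∀ τ ∈ entries, τ.1 = vertex

namespace EntrySet

variable {C : OneChart A V}

/-- The vertices other than the vertex `v` of `U` on paths that start with a transition in `U` and
continue onward until `v` is reached again. -/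
inductive Body (U : C.EntrySet) : V → Prop
  | entry {v w : V} {l : Option A} : (v, l, w) ∈ U.entries → w ≠ U.vertex → Body U w
  | step {v w : V} {l : Option A} : Body U v → (v, l, w) ∈ C.trans → w ≠ U.vertex → Body U w

theorem Body.mem_verts {U : C.EntrySet} {w : V} (h : U.Body w) : w ∈ C.verts := by
  cases h with
  | entry h _ => exact (C.trans_mem _ (U.entries_subset h)).2
  | step _ h _ => exact (C.trans_mem _ h).2

/-- The sub-1-chart of `C` that is induced by `U`: it is formed by all vertices and transitions on
paths that start with a transition in `U` and continue onward until the vertex of `U` is reached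
again. -/
def subchart (U : C.EntrySet) : OneChart A V where
  verts := {w | w = U.vertex ∨ U.Body w}
  finite_verts := C.finite_verts.subset (by
    rintro w (rfl | h)
    · exact U.vertex_mem
    · exact h.mem_verts)
  start := U.vertex
  start_mem := Or.inl rfl
  trans := {τ | τ ∈ U.entries ∨ (τ ∈ C.trans ∧ U.Body τ.1)}
  trans_mem := by
    rintro ⟨v, l, w⟩ (h | ⟨h, hb⟩)
    · refine ⟨Or.inl (U.entries_source _ h), ?_⟩
      by_cases hw : w = U.vertex
      · exact Or.inl hw
      · exact Or.inr (Body.entry h hw)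
    · refine ⟨Or.inr hb, ?_⟩
      by_cases hw : w = U.vertex
      · exact Or.inl hw
      · exact Or.inr (Body.step hb h hw)
  term := {w | w ∈ C.term ∧ (w = U.vertex ∨ U.Body w)}
  term_subset := fun _ h => h.2

end EntrySet

/-- The 1-chart that arises from `C` by removing all transitions in `T`, and then all vertices and
transitions that are unreachable from the start vertex. -/
def remove (C : OneChart A V) (T : Set (Transition A V)) : OneChart A V where
  verts := {w | Relation.ReflTransGen (fun x y => ∃ l, (x, l, y) ∈ C.trans \ T) C.start w}
  finite_verts := C.finite_verts.subset (by
    intro w h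
    cases h with
    | refl => exact C.start_mem
    | tail _ h => exact (C.trans_mem _ h.choose_spec.1).2)
  start := C.start
  start_mem := Relation.ReflTransGen.refl
  trans := {τ | τ ∈ C.trans \ T ∧
    Relation.ReflTransGen (fun x y => ∃ l, (x, l, y) ∈ C.trans \ T) C.start τ.1}
  trans_mem := fun τ h => ⟨h.2, h.2.tail ⟨τ.2.1, h.1⟩⟩
  term := {w | w ∈ C.term ∧
    Relation.ReflTransGen (fun x y => ∃ l, (x, l, y) ∈ C.trans \ T) C.start w}
  term_subset := fun _ h => h.2

/-- The sub-1-charts induced by `Us` can be eliminated from `C` in one multi-step: there is at least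
one, all of them are loop 1-charts, their sets of loop-entry transitions are disjoint, and no start
vertex of one of them is in the body of another one. -/
structure IsMultiStep (C : OneChart A V) (Us : List C.EntrySet) : Prop where
  ne_nil : Us ≠ []
  isLoop : ∀ U ∈ Us, U.subchart.IsLoop
  pairwise : Us.Pairwise fun U U' =>
    Disjoint U.entries U'.entries ∧ ¬ U'.Body U.vertex ∧ ¬ U.Body U'.vertex

/-- The set of all loop-entry transitions of a list of loop sub-1-charts. -/
def entriesOf {C : OneChart A V} (Us : List C.EntrySet) : Set (Transition A V) :=
  {τ | ∃ U ∈ Us, τ ∈ U.entries}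

/-- The set of all vertices in the bodies of a list of loop sub-1-charts. -/
def bodiesOf {C : OneChart A V} (Us : List C.EntrySet) : Set V :=
  {w | ∃ U ∈ Us, U.Body w}

/-- `LayeredRun C B Ts`: there is a successful run of multi-step loop elimination from `C` to a
1-chart without an infinite path such that `Ts` lists the sets of loop-entry transitions that are
removed in the successive multi-steps, and no removed loop-entry transition departs from a vertex in
`B` or in the body of a loop sub-1-chart that was eliminated in a previous multi-step. -/
inductive LayeredRun : OneChart A V → Set V → List (Set (Transition A V)) → Prop
  | done {C : OneChart A V} {B : Set V} : (¬ ∃ π, C.IsInfinitePath π) → LayeredRun C B []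
  | step {C : OneChart A V} {B : Set V} {Ts : List (Set (Transition A V))}
      (Us : List C.EntrySet) : C.IsMultiStep Us → (∀ U ∈ Us, U.vertex ∉ B) →
      LayeredRun (C.remove (entriesOf Us)) (B ∪ bodiesOf Us) Ts →
      LayeredRun C B (entriesOf Us :: Ts)

/-- The marking `m` of transitions by natural numbers is (the entry/body-labeling of) an
LLEE-witness of `C`: it records a successful layered run of multi-step loop elimination from `C`, by
attaching `n ≥ 1` to the loop-entry transitions that are removed in the `n`-th multi-step, and `0`
to all other transitions. -/
def IsLLEEWitness (C : OneChart A V) (m : Transition A V → ℕ) : Prop :=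
  ∃ Ts : List (Set (Transition A V)), LayeredRun C ∅ Ts ∧
    ∀ τ ∈ C.trans, ∀ n, m τ = n + 1 ↔ ∃ T, Ts[n]? = some T ∧ τ ∈ T

/-- `C` is a guarded LLEE-1-chart: it has an LLEE-witness all of whose loop-entry transitions are
proper. -/
def IsGuardedLLEE (C : OneChart A V) : Prop :=
  ∃ m, C.IsLLEEWitness m ∧ ∀ τ ∈ C.trans, m τ ≠ 0 → τ.2.1 ≠ none

/-- The star expression for a transition label: `a` for a proper action `a`, and `1` for the
empty-step label. -/
def labelExp : Option A → StExp A
  | none => .one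
  | some a => .act a

open Classical in
/-- The termination constant of `C` at `v`. -/
noncomputable def termConst (C : OneChart A V) (v : V) : StExp A :=
  if v ∈ C.term then .one else .zero

/-- The star expression function `s` is an `S`-provable solution of `C`: at every vertex `v` with a
list representation `l` of the transitions from `v`. (For systems `S` that extend `ACI` the choice
of the list does not matter.) -/
def IsSolution (S : ProofSystem A) (C : OneChart A V) (s : V → StExp A) : Prop :=
  ∀ v ∈ C.verts, ∃ l : List (Option A × V), (∀ a w, (a, w) ∈ l ↔ (v, a, w) ∈ C.trans) ∧
    S.Derivable (s v)
      (.add (C.termConst v) (StExp.sum (l.map fun p => .mul (labelExp p.1) (s p.2))))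

end OneChart

/-! ### Coinductive proofs, and the simple coinductive variant of Milner's system -/

section Coinductive

variable {A : Type u}

/-- Coinductive proofs over `S` of the equation `E`. -/
structure CoindProof (S : ProofSystem A) (E : Equation A) (V : Type) : Type u where
  chart : OneChart A V
  weaklyGuarded : chart.WeaklyGuarded
  label : V → Equation A
  solution_lhs : chart.IsSolution S fun v => (label v).lhs
  solution_rhs : chart.IsSolution S fun v => (label v).rhs
  label_start : label chart.start = E

/-- There is an LLEE-witnessed coinductive proof over `S` of the equation `E`. -/
def LLEECoindProvable (S : ProofSystem A) (E : Equation A) : Prop :=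
  ∃ (V : Type) (P : CoindProof S E V), P.chart.IsGuardedLLEE

variable (A)

/-- The set of instances of the rule `LCoProof_n`: from the `n` premises in `Γ` infer `E`, if there
is an LLEE-witnessed coinductive proof of `E` over `Mil⁻ + Γ`. -/
def lcoProofRule (n : ℕ) : Set (Inference A) :=
  {ι | ι.1.length = n ∧ LLEECoindProvable ((milMinus A).addAxioms {E | E ∈ ι.1}) ι.2}

/-- The simple coinductive variant `cMil₁ = Mil⁻ + LCoProof_1` of Milner's system. -/
def cMilOne : ProofSystem A := (milMinus A).addRule (.lcoProof 1) (lcoProofRule A 1)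

end Coinductive

/-! ### The proof transformation, and effectivity -/

/-- Replaces the name `RSP*` by the name `LCoProof_1`. -/
def RuleName.replaceRSPStar : RuleName → RuleName
  | refl => refl
  | symm => symm
  | trans => trans
  | cxt => cxt
  | rspStar => lcoProof 1
  | lcoProof n => lcoProof n

/-- Replaces, in a prooftree, every instance of `RSP*` by an instance of `LCoProof_1` with the same
premise and the same conclusion. -/
def ProofTree.replaceRSPStar {A : Type u} : ProofTree A → ProofTree A
  | assm E => assm E
  | ax E => ax E
  | node r n sub E => node r.replaceRSPStar n (fun i => (sub i).replaceRSPStar) E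

/-- The symbols of the words by which prooftrees are represented: a pair `(k, i)` stands for the
`i`-th symbol of kind `k`. -/
abbrev Symb : Type := ℕ × ℕ

section Words

variable {A : Type u} (ν : A → ℕ)

/-- Star expressions as words in prefix notation, for a numbering `ν` of the actions. -/
def StExp.word : StExp A → List Symb
  | zero => [(0, 0)]
  | one => [(0, 1)]
  | act a => [(1, ν a)]
  | add e f => (0, 2) :: (e.word ++ f.word)
  | mul e f => (0, 3) :: (e.word ++ f.word)
  | star e => (0, 4) :: e.word

/-- Equations as words. -/
def Equation.word (E : Equation A) : List Symb := E.lhs.word ν ++ E.rhs.word ν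

/-- Numbers of rule names. -/
def RuleName.number : RuleName → ℕ
  | refl => 0
  | symm => 1
  | trans => 2
  | cxt => 3
  | rspStar => 4
  | lcoProof n => n + 5

/-- Prooftrees as words in prefix notation: an inner node is represented by its rule, the number of
its subtrees, its conclusion, and the words for its subtrees. -/
def ProofTree.word : ProofTree A → List Symb
  | assm E => (2, 0) :: E.word ν
  | ax E => (2, 1) :: E.word ν
  | node r n sub E =>
      (3, r.number) :: (4, n) :: (E.word ν ++ (List.ofFn fun i => (sub i).word).flatten)

end Words

/-- The transformation `T` of prooftrees is effective: there is an algorithm that computes the word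
for `T D` from the word for `D`, for all prooftrees `D` and all numberings `ν` of the actions. (Since
only finitely many actions occur in a prooftree, arbitrary, also uncountable, sets of actions are
covered; words determine prooftrees if `ν` is injective on the actions that occur.) -/
def Effective {A : Type u} (T : ProofTree A → ProofTree A) : Prop :=
  ∃ t : List Symb → List Symb, Computable t ∧
    ∀ (ν : A → ℕ) (D : ProofTree A), t (D.word ν) = (T D).word ν

end Milner

/-!
An instance of `RSP*`, from `e = f · e + g` infer `e = f* · g`, is justified by a guarded
LLEE-1-chart for `f* · g` on which both `e` and `f* · g` extend to provable solutions.

The vertices of this 1-chart are lists `[e₁, …, eₙ]` of star expressions that stand for the products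
`e₁ · (⋯ · eₙ)`, with `[f*, g · 1]` as the start vertex. A list performs an action of its first
expression, which is replaced by a derivative (`StExp.der`, `outs`), or it drops its first
expression by a `1`-transition if this expression permits immediate termination. Only the empty list
terminates. A derivative `M` of `e` leads from `e* :: K` to `M ++ e* :: K`, so that the loops
from `e* :: K` consist of lists that end with `e* :: K`. If however `M` contains an expression that
cannot terminate, then `e*` is not put on the list, which is sound because such expressions
provably absorb what follows them (`mk_mul_of_not_normed`).

The loop-entry transitions are those whose source is a suffix of their target. They are eliminated
in the order of the size of the first expression of their source: in a loop body, a list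
`M ++ e* :: K` has only expressions in `M` of smaller size than `e*`, and all
transitions that are not loop-entry transitions decrease the sum of the sizes of the expressions
(`weight_lt_or_of_mem_outs`). That such data suffice for a guarded LLEE-witness is
`OneChart.LayeredWitness.isGuardedLLEE`.

Provable equations are verified in the quotient `ProvQuot Γ` of star expressions by provable
equality in `Mil⁻ + Γ`. The product of the expressions in a list is a solution by the fundamental
theorem `mk_mul_eq`. A second solution arises by interpreting the list `[f*, g · 1]` at the end of
vertices as `e` (`prodTail_eq_sum_outs`); at the start vertex its correctness condition is the
premise `e = f · e + g`, as `f` does not permit immediate termination.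

On words, the proof transformation replaces one symbol, that of the rule `RSP*`, wherever it occurs.
-/

namespace Milner

variable {A : Type*}

/-! ### Star expressions modulo provable equality -/

section Quotient

variable (Γ : Set (Equation A))

theorem derivable_of_rule {S : ProofSystem A} {r : RuleName} {e f : StExp A}
    (Es : List (Equation A)) (hr : (Es, ⟨e, f⟩) ∈ S.rule r)
    (h : ∀ E ∈ Es, S.Derivable E.lhs E.rhs) : S.Derivable e f := by
  have h' : ∀ i : Fin Es.length, ∃ D : ProofTree A, D.IsDerivation S ∅ ∧ D.concl = Es.get i :=
    fun i => h _ (Es.get_mem i)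
  choose D hD hc using h'
  refine ⟨.node r Es.length D ⟨e, f⟩, ⟨hD, ?_⟩, rfl⟩
  have : (List.ofFn fun i => (D i).concl) = Es := by
    simp only [hc]
    exact List.ofFn_get Es
  rwa [this]

theorem derivable_milAxiom {e f : StExp A} (h : MilAxiom A ⟨e, f⟩) :
    ((milMinus A).addAxioms Γ).Derivable e f :=
  ⟨.ax ⟨e, f⟩, Or.inl h, rfl⟩

theorem derivable_addAxioms {e f : StExp A} (h : (⟨e, f⟩ : Equation A) ∈ Γ) :
    ((milMinus A).addAxioms Γ).Derivable e f :=
  ⟨.ax ⟨e, f⟩, Or.inr h, rfl⟩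

variable {Γ}

theorem derivable_refl (e : StExp A) : ((milMinus A).addAxioms Γ).Derivable e e :=
  derivable_of_rule [] (ELRule.refl e) (by simp)

theorem derivable_symm {e f : StExp A} (h : ((milMinus A).addAxioms Γ).Derivable e f) :
    ((milMinus A).addAxioms Γ).Derivable f e :=
  derivable_of_rule [⟨e, f⟩] (ELRule.symm e f) (by simpa using h)

theorem derivable_trans {e f g : StExp A} (h : ((milMinus A).addAxioms Γ).Derivable e f)
    (h' : ((milMinus A).addAxioms Γ).Derivable f g) :
    ((milMinus A).addAxioms Γ).Derivable e g :=
  derivable_of_rule [⟨e, f⟩, ⟨f, g⟩] (ELRule.trans e f g) (by simpa using ⟨h, h'⟩)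

theorem derivable_fill (C : Ctx A) {e f : StExp A}
    (h : ((milMinus A).addAxioms Γ).Derivable e f) :
    ((milMinus A).addAxioms Γ).Derivable (C.fill e) (C.fill f) :=
  derivable_of_rule [⟨e, f⟩] (ELRule.cxt C e f) (by simpa using h)

variable (Γ)

/-- Provable equality in `Mil⁻ + Γ`. -/
def provSetoid : Setoid (StExp A) where
  r := ((milMinus A).addAxioms Γ).Derivable
  iseqv := ⟨derivable_refl, derivable_symm, derivable_trans⟩

/-- Star expressions modulo provable equality in `Mil⁻ + Γ`. -/
def ProvQuot : Type _ := Quotient (provSetoid Γ)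

namespace ProvQuot

/-- The class of a star expression modulo provable equality in `Mil⁻ + Γ`. -/
def mk (e : StExp A) : ProvQuot Γ := Quotient.mk (provSetoid Γ) e

variable {Γ}

theorem mk_eq_mk {e f : StExp A} :
    mk Γ e = mk Γ f ↔ ((milMinus A).addAxioms Γ).Derivable e f :=
  ⟨fun h => Quotient.exact h, fun h => Quotient.sound (s := provSetoid Γ) h⟩

theorem mk_eq_of_milAxiom {e f : StExp A} (h : MilAxiom A ⟨e, f⟩) : mk Γ e = mk Γ f :=
  mk_eq_mk.2 (derivable_milAxiom Γ h)

theorem exists_mk_eq (x : ProvQuot Γ) : ∃ e, mk Γ e = x := Quotient.exists_rep x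

instance : Zero (ProvQuot Γ) := ⟨mk Γ .zero⟩

instance : One (ProvQuot Γ) := ⟨mk Γ .one⟩

instance : Add (ProvQuot Γ) :=
  ⟨Quotient.map₂ StExp.add fun _ f h e' _ h' =>
    derivable_trans (derivable_fill (.addLeft .hole e') h) (derivable_fill (.addRight f .hole) h')⟩

instance : Mul (ProvQuot Γ) :=
  ⟨Quotient.map₂ StExp.mul fun _ f h e' _ h' =>
    derivable_trans (derivable_fill (.mulLeft .hole e') h) (derivable_fill (.mulRight f .hole) h')⟩

/-- Iteration of classes of star expressions. -/
def star : ProvQuot Γ → ProvQuot Γ :=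
  Quotient.map StExp.star fun _ _ h => derivable_fill (.star .hole) h

theorem mk_zero : mk Γ .zero = 0 := rfl
theorem mk_one : mk Γ .one = 1 := rfl
theorem mk_add (e f : StExp A) : mk Γ (.add e f) = mk Γ e + mk Γ f := rfl
theorem mk_mul (e f : StExp A) : mk Γ (.mul e f) = mk Γ e * mk Γ f := rfl
theorem mk_star (e : StExp A) : mk Γ (.star e) = star (mk Γ e) := rfl

/-- `Mil⁻` does not prove left-distributivity and `e · 0 = 0`, so that this is only a part of the
structure of a semiring. -/
instance : AddCommMonoid (ProvQuot Γ) where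
  add_assoc := by
    rintro ⟨e⟩ ⟨f⟩ ⟨g⟩
    exact mk_eq_of_milAxiom (.assocAdd e f g)
  zero_add := by
    rintro ⟨e⟩
    exact (mk_eq_of_milAxiom (.commAdd .zero e)).trans (mk_eq_of_milAxiom (.neutralAdd e))
  add_zero := by
    rintro ⟨e⟩
    exact mk_eq_of_milAxiom (.neutralAdd e)
  add_comm := by
    rintro ⟨e⟩ ⟨f⟩
    exact mk_eq_of_milAxiom (.commAdd e f)
  nsmul := nsmulRec

instance : Monoid (ProvQuot Γ) where
  mul_assoc := by
    rintro ⟨e⟩ ⟨f⟩ ⟨g⟩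
    exact mk_eq_of_milAxiom (.assocMul e f g)
  one_mul := by
    rintro ⟨e⟩
    exact mk_eq_of_milAxiom (.idLeftMul e)
  mul_one := by
    rintro ⟨e⟩
    exact mk_eq_of_milAxiom (.idRightMul e)

instance : RightDistribClass (ProvQuot Γ) where
  right_distrib := by
    rintro ⟨e⟩ ⟨f⟩ ⟨g⟩
    exact mk_eq_of_milAxiom (.rDistr e f g)

theorem deadlock (x : ProvQuot Γ) : 0 * x = 0 := by
  obtain ⟨e, rfl⟩ := exists_mk_eq x
  exact mk_eq_of_milAxiom (.deadlock e)

theorem add_idem (x : ProvQuot Γ) : x + x = x := by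
  obtain ⟨e, rfl⟩ := exists_mk_eq x
  exact mk_eq_of_milAxiom (.idempotAdd e)

theorem star_eq (x : ProvQuot Γ) : star x = 1 + x * star x := by
  obtain ⟨e, rfl⟩ := exists_mk_eq x
  exact mk_eq_of_milAxiom (.recStar e)

theorem star_one_add (x : ProvQuot Γ) : star (1 + x) = star x := by
  obtain ⟨e, rfl⟩ := exists_mk_eq x
  exact (mk_eq_of_milAxiom (.trmBodyStar e)).symm

theorem list_sum_mul (l : List (ProvQuot Γ)) (x : ProvQuot Γ) :
    l.sum * x = (l.map (· * x)).sum := by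
  induction l with
  | nil => simp [deadlock]
  | cons y l ih => simp [add_mul, ih]

theorem mk_sum (es : List (StExp A)) : mk Γ (StExp.sum es) = (es.map (mk Γ)).sum := by
  cases es with
  | nil => rfl
  | cons e es =>
    rw [StExp.sum, List.map_cons, List.sum_cons]
    induction es generalizing e with
    | nil => simp
    | cons f es ih => rw [List.foldl_cons, ih, mk_add, List.map_cons, List.sum_cons, add_assoc]

variable (Γ)

/-- The product of the classes of the expressions in a list. -/
def prod (L : List (StExp A)) : ProvQuot Γ := (L.map (mk Γ)).prod

variable {Γ}

@[simp]
theorem prod_nil : prod Γ ([] : List (StExp A)) = 1 := rfl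

@[simp]
theorem prod_cons (e : StExp A) (L : List (StExp A)) : prod Γ (e :: L) = mk Γ e * prod Γ L := by
  simp [prod]

@[simp]
theorem prod_append (L K : List (StExp A)) : prod Γ (L ++ K) = prod Γ L * prod Γ K := by
  simp [prod]

end ProvQuot

end Quotient

/-! ### Derivatives of star expressions -/

namespace StExp

/-- `e` is normed: the process that is denoted by `e` has a run that terminates. -/
def Normed : StExp A → Prop
  | zero => False
  | one => True
  | act _ => True
  | add e f => e.Normed ∨ f.Normed
  | mul e f => e.Normed ∧ f.Normed
  | star _ => True

open Classical in
/-- The action derivatives of a star expression: `(a, [e₁, …, eₙ])` stands for an `a`-transition to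
the product `e₁ · (⋯ · eₙ)`. A derivative of `e` is followed by `e*` in a derivative of `e*` only if
it can terminate: otherwise, `e*` would never be reached again, and the transition could not belong
to a loop. -/
noncomputable def der : StExp A → List (A × List (StExp A))
  | zero => []
  | one => []
  | act a => [(a, [])]
  | add e f => e.der ++ f.der
  | mul e f => e.der.map (fun p => (p.1, p.2 ++ [f])) ++ if e.Terminates then f.der else []
  | star e => e.der.map fun p => (p.1, if ∀ x ∈ p.2, x.Normed then p.2 ++ [star e] else p.2)

theorem terminates_add {e f : StExp A} :
    (add e f).Terminates ↔ e.Terminates ∨ f.Terminates := by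
  constructor
  · rintro (_ | h | h)
    · exact Or.inl h
    · exact Or.inr h
  · rintro (h | h)
    · exact .add_left h
    · exact .add_right h

theorem terminates_mul {e f : StExp A} :
    (mul e f).Terminates ↔ e.Terminates ∧ f.Terminates := by
  constructor
  · rintro ⟨⟩
    exact ⟨‹_›, ‹_›⟩
  · exact fun h => .mul h.1 h.2

theorem not_terminates_zero : ¬ (zero : StExp A).Terminates := nofun

theorem not_terminates_act (a : A) : ¬ (act a).Terminates := nofun

theorem Normed.terminates_or_exists_der {e : StExp A} (h : e.Normed) :
    e.Terminates ∨ ∃ p ∈ e.der, ∀ x ∈ p.2, x.Normed := by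
  induction e with
  | zero => exact h.elim
  | one => exact Or.inl .one
  | act a => exact Or.inr ⟨(a, []), by simp [der], by simp⟩
  | add e f ihe ihf =>
    rcases h with h | h
    · rcases ihe h with h | ⟨p, hp, hn⟩
      · exact Or.inl (.add_left h)
      · exact Or.inr ⟨p, by simp [der, hp], hn⟩
    · rcases ihf h with h | ⟨p, hp, hn⟩
      · exact Or.inl (.add_right h)
      · exact Or.inr ⟨p, by simp [der, hp], hn⟩
  | mul e f ihe ihf =>
    rcases ihe h.1 with he | ⟨p, hp, hn⟩
    · rcases ihf h.2 with hf | ⟨p, hp, hn⟩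
      · exact Or.inl (.mul he hf)
      · exact Or.inr ⟨p, by simp [der, hp, he], hn⟩
    · refine Or.inr ⟨(p.1, p.2 ++ [f]), ?_, ?_⟩
      · simp only [der, List.mem_append, List.mem_map]
        exact Or.inl ⟨p, hp, rfl⟩
      · intro x hx
        rcases List.mem_append.1 hx with hx | hx
        · exact hn x hx
        · rw [List.mem_singleton.1 hx]
          exact h.2
  | star e => exact Or.inl .star

end StExp

open ProvQuot

section Fundamental

variable {Γ : Set (Equation A)}

theorem mk_mul_of_not_normed {e : StExp A} (h : ¬ e.Normed) (x : ProvQuot Γ) :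
    mk Γ e * x = mk Γ e := by
  induction e generalizing x with
  | zero => exact deadlock x
  | one => exact (h trivial).elim
  | act a => exact (h trivial).elim
  | add e f ihe ihf =>
    rw [StExp.Normed, not_or] at h
    rw [mk_add, add_mul, ihe h.1, ihf h.2]
  | mul e f ihe ihf =>
    rw [StExp.Normed] at h
    rw [mk_mul, mul_assoc]
    by_cases he : e.Normed
    · rw [ihf fun hf => h ⟨he, hf⟩]
    · rw [ihe he, ihe he]
  | star e => exact (h trivial).elim

theorem prod_mul_of_not_normed {L : List (StExp A)} (h : ¬ ∀ x ∈ L, x.Normed) (y : ProvQuot Γ) :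
    prod Γ L * y = prod Γ L := by
  induction L with
  | nil => simp at h
  | cons e L ih =>
    rw [prod_cons, mul_assoc]
    by_cases he : e.Normed
    · rw [ih (by simpa [he] using h)]
    · rw [mk_mul_of_not_normed he, mk_mul_of_not_normed he]

open Classical in
/-- Every star expression is provably equal to the sum of its termination constant and its
action-prefixed derivatives; here this is multiplied with `x` from the right. -/
theorem mk_mul_eq (e : StExp A) (x : ProvQuot Γ) :
    mk Γ e * x = (if e.Terminates then x else 0) +
      (e.der.map fun p => mk Γ (.act p.1) * (prod Γ p.2 * x)).sum := by
  induction e generalizing x with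
  | zero => simp [StExp.der, mk_zero, deadlock, StExp.not_terminates_zero]
  | one => simp [StExp.der, mk_one, StExp.Terminates.one]
  | act a => simp [StExp.der, StExp.not_terminates_act]
  | add e f ihe ihf =>
    rw [mk_add, add_mul, ihe, ihf, StExp.der, List.map_append, List.sum_append,
      add_add_add_comm]
    congr 1
    by_cases he : e.Terminates <;> by_cases hf : f.Terminates <;>
      simp [StExp.terminates_add, he, hf, add_idem]
  | mul e f ihe ihf =>
    rw [mk_mul, mul_assoc, ihe, StExp.der, List.map_append, List.sum_append, List.map_map]
    have : (e.der.map ((fun p => mk Γ (.act p.1) * (prod Γ p.2 * x)) ∘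
        fun p => (p.1, p.2 ++ [f]))).sum =
        (e.der.map fun p => mk Γ (.act p.1) * (prod Γ p.2 * (mk Γ f * x))).sum := by
      simp [Function.comp_def, mul_assoc]
    rw [this]
    by_cases he : e.Terminates
    · rw [if_pos he, if_pos he, ihf]
      simp only [StExp.terminates_mul, he, true_and]
      abel
    · simp [StExp.terminates_mul, he]
  | star e ih =>
    set s := (e.der.map fun p => mk Γ (.act p.1) * (prod Γ p.2 * 1)).sum with hs
    have hstar : star (mk Γ e) = star s := by
      have := ih 1
      rw [mul_one, ← hs] at this
      rw [this]
      split_ifs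
      · exact star_one_add s
      · rw [zero_add]
    rw [mk_star, hstar, star_eq, add_mul, one_mul, if_pos .star, hs, list_sum_mul, list_sum_mul,
      ← hs, StExp.der, List.map_map, List.map_map, List.map_map]
    congr 2
    refine List.map_congr_left fun p _ => ?_
    simp only [Function.comp_apply, mul_one, mul_assoc]
    split_ifs with hp
    · rw [prod_append, prod_cons, prod_nil, mk_star, hstar, mul_one, mul_assoc]
    · rw [prod_mul_of_not_normed hp, prod_mul_of_not_normed hp]

end Fundamental

/-! ### A criterion for guarded LLEE-1-charts -/

namespace OneChart

variable {V : Type}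

/-- Local data on a 1-chart from which a layered run of loop elimination can be assembled.
The loop-entry transitions are eliminated in the order of the levels of their sources. -/
structure LayeredWitness (C : OneChart A V) where
  /-- The loop-entry transitions. -/
  entry : Set (Transition A V)
  /-- The level at which the loops from a vertex are eliminated. -/
  level : V → ℕ
  /-- A measure that decreases along all transitions that are not loop-entry transitions. -/
  weight : V → ℕ
  /-- A relation that contains all pairs of a vertex `v` and a vertex in the body of a loop
  sub-1-chart from `v`. -/
  Under : V → V → Prop
  /-- A relation that relates `v` only to vertices from which there is a path to `v` without
  loop-entry transitions. -/
  Returns : V → V → Prop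
  proper : ∀ τ ∈ C.trans, τ ∈ entry → τ.2.1 ≠ none
  weight_lt : ∀ v l w, (v, l, w) ∈ C.trans → (v, l, w) ∉ entry → weight w < weight v
  entry_under : ∀ v l w, (v, l, w) ∈ C.trans → (v, l, w) ∈ entry →
    w = v ∨ Under v w ∧ Returns v w
  step_under : ∀ v w l w', Under v w → (w, l, w') ∈ C.trans → w' = v ∨ Under v w'
  under_level : ∀ v w, Under v w → level w < level v
  under_term : ∀ v w, Under v w → w ∉ C.term
  step_returns : ∀ v w, Returns v w →
    ∃ l w', (w, l, w') ∈ C.trans ∧ (w, l, w') ∉ entry ∧ (w' = v ∨ Returns v w')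

theorem not_exists_infinitePath {C : OneChart A V} (weight : V → ℕ)
    (h : ∀ v l w, (v, l, w) ∈ C.trans → weight w < weight v) : ¬ ∃ π, C.IsInfinitePath π := by
  rintro ⟨π, hπ⟩
  refine not_strictAnti_of_wellFoundedLT (fun i => weight (π i)) (strictAnti_nat_of_succ_lt ?_)
  intro i
  obtain ⟨l, hl⟩ := hπ i
  exact h _ _ _ hl

theorem mem_verts_of_mem_remove {C : OneChart A V} {T : Set (Transition A V)} {v : V}
    (h : v ∈ (C.remove T).verts) : v ∈ C.verts := by
  cases h with
  | refl => exact C.start_mem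
  | tail _ h => exact (C.trans_mem _ h.choose_spec.1).2

namespace LayeredWitness

variable {C₀ : OneChart A V} (W : C₀.LayeredWitness)

/-- The set of all loop-entry transitions of `C` from `v`. -/
def entrySet (C : OneChart A V) (v : V) (hv : v ∈ C.verts)
    (h : ∃ τ ∈ C.trans, τ.1 = v ∧ τ ∈ W.entry) : C.EntrySet where
  vertex := v
  vertex_mem := hv
  entries := {τ | τ ∈ C.trans ∧ τ.1 = v ∧ τ ∈ W.entry}
  entries_nonempty := h
  entries_subset _ hτ := hτ.1
  entries_source _ hτ := hτ.2.1

variable {W} {C : OneChart A V}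

theorem under_of_body (hC : C.trans ⊆ C₀.trans) {v : V} {hv : v ∈ C.verts}
    {h : ∃ τ ∈ C.trans, τ.1 = v ∧ τ ∈ W.entry} {w : V} (hw : (W.entrySet C v hv h).Body w) :
    W.Under v w := by
  induction hw with
  | entry he hne =>
    obtain ⟨ht, rfl, he⟩ := he
    exact ((W.entry_under _ _ _ (hC ht) he).resolve_left hne).1
  | step _ ht hne ih => exact (W.step_under _ _ _ _ ih (hC ht)).resolve_left hne

/-- Suppose that all loop-entry transitions from vertices of lower level than `v` have been removed.
Then the loop-entry transitions from `v` induce a loop sub-1-chart: in its body only transitions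
remain that decrease the weight, so that every path has to leave the body. -/
theorem isLoop_subchart (hC : C.trans ⊆ C₀.trans) (hT : C.term ⊆ C₀.term)
    (hrest : ∀ v ∈ C.verts, ∀ l w, (v, l, w) ∈ C₀.trans → (v, l, w) ∉ W.entry →
      (v, l, w) ∈ C.trans)
    (v : V) (hlev : ∀ τ ∈ C.trans, τ ∈ W.entry → W.level v ≤ W.level τ.1)
    (hv : v ∈ C.verts) (h : ∃ τ ∈ C.trans, τ.1 = v ∧ τ ∈ W.entry) :
    (W.entrySet C v hv h).subchart.IsLoop := by
  set U := W.entrySet C v hv h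
  have hbody : ∀ {w}, U.Body w → W.Under v w := fun hw => under_of_body hC hw
  have hnv : ¬ U.Body v := fun hb => (W.under_level _ _ (hbody hb)).false
  refine ⟨?_, ?_, ?_⟩
  · let X : V → Prop := fun w => w = v ∨ U.Body w ∧ W.Returns v w
    have hX : ∀ x : {w // X w}, ∃ y : {w // X w}, ∃ l, (x.1, l, y.1) ∈ U.subchart.trans := by
      rintro ⟨w, hwv | ⟨hb, hr⟩⟩
      · simp only [hwv]
        obtain ⟨⟨u, l, w'⟩, ht, hu, he⟩ := h
        have hu : u = v := hu
        rw [hu] at ht he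
        have hmem : (v, l, w') ∈ U.entries := ⟨ht, rfl, he⟩
        by_cases hw : w' = v
        · exact ⟨⟨w', Or.inl hw⟩, l, Or.inl hmem⟩
        · refine ⟨⟨w', Or.inr ⟨.entry hmem hw, ?_⟩⟩, l, Or.inl hmem⟩
          exact ((W.entry_under _ _ _ (hC ht) he).resolve_left hw).2
      · obtain ⟨l, w', ht, he, hw'⟩ := W.step_returns _ _ hr
        have ht' := hrest w hb.mem_verts l w' ht he
        by_cases hw : w' = v
        · exact ⟨⟨w', Or.inl hw⟩, l, Or.inr ⟨ht', hb⟩⟩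
        · exact ⟨⟨w', Or.inr ⟨.step hb ht' hw, hw'.resolve_left hw⟩⟩, l, Or.inr ⟨ht', hb⟩⟩
    choose next hnext using hX
    refine ⟨fun i => (next^[i] ⟨v, Or.inl rfl⟩).1, fun i => ?_, rfl⟩
    simp only [Function.iterate_succ_apply']
    exact hnext _
  · intro π hπ h0
    by_contra! hne
    have hb : ∀ i, U.Body (π (i + 1)) := by
      intro i
      induction i with
      | zero =>
        obtain ⟨l, hl | ⟨_, hl⟩⟩ := hπ 0
        · exact .entry hl (hne 1 one_pos)
        · rw [h0] at hl
          exact (hnv hl).elim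
      | succ i ih =>
        obtain ⟨l, hl | ⟨hl, _⟩⟩ := hπ (i + 1)
        · exact (hne (i + 1) i.succ_pos (U.entries_source _ hl)).elim
        · exact .step ih hl (hne _ (Nat.succ_pos _))
    refine not_strictAnti_of_wellFoundedLT (fun i => W.weight (π (i + 1)))
      (strictAnti_nat_of_succ_lt fun i => ?_)
    obtain ⟨l, hl | ⟨hl, _⟩⟩ := hπ (i + 1)
    · exact (hne (i + 1) i.succ_pos (U.entries_source _ hl)).elim
    · refine W.weight_lt _ _ _ (hC hl) fun he => ?_
      exact (hlev _ hl he).not_gt (W.under_level _ _ (hbody (hb i)))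
  · rintro w ⟨hw, rfl | hb⟩
    · rfl
    · exact (W.under_term _ _ (hbody hb) (hT hw)).elim

variable (W)

/-- Here `C` is the 1-chart that is left after the loop-entry transitions of level below `n` have
been removed, and `B` contains the bodies of the loops that have been eliminated. -/
theorem exists_layeredRun (k n : ℕ) (C : OneChart A V) (B : Set V)
    (hk : ∀ v ∈ C.verts, W.level v < n + k) (hC : C.trans ⊆ C₀.trans) (hT : C.term ⊆ C₀.term)
    (hrest : ∀ v ∈ C.verts, ∀ l w, (v, l, w) ∈ C₀.trans → (v, l, w) ∉ W.entry →
      (v, l, w) ∈ C.trans)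
    (hlev : ∀ τ ∈ C.trans, τ ∈ W.entry → n ≤ W.level τ.1) (hB : ∀ v ∈ B, W.level v < n) :
    ∃ Ts, LayeredRun C B Ts ∧ ∀ T ∈ Ts, T ⊆ W.entry := by
  induction k generalizing n C B with
  | zero =>
    refine ⟨[], .done (not_exists_infinitePath W.weight fun v l w ht => ?_), by simp⟩
    refine W.weight_lt _ _ _ (hC ht) fun he => ?_
    exact (hlev _ ht he).not_gt (hk _ (C.trans_mem _ ht).1)
  | succ k ih =>
    set s : Set V := {v | v ∈ C.verts ∧ W.level v = n ∧ ∃ τ ∈ C.trans, τ.1 = v ∧ τ ∈ W.entry}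
    have hlev' : ∀ τ ∈ C.trans, τ ∈ W.entry → τ.1 ∉ s → n + 1 ≤ W.level τ.1 := by
      intro τ ht he hτ
      refine lt_of_le_of_ne (hlev τ ht he) fun hn => hτ ?_
      exact ⟨(C.trans_mem _ ht).1, hn.symm, τ, ht, rfl, he⟩
    rcases s.eq_empty_or_nonempty with hse | hsne
    · refine ih (n + 1) C B (fun v hv => ?_) hC hT hrest (fun τ ht he => ?_) fun v hv => ?_
      · have := hk v hv
        omega
      · exact hlev' τ ht he (by simp [hse])
      · exact (hB v hv).trans n.lt_succ_self
    · have hfin : s.Finite := C.finite_verts.subset fun v hv => hv.1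
      have := hfin.fintype
      let f : s → C.EntrySet := fun v => W.entrySet C v.1 v.2.1 v.2.2.2
      let Us : List C.EntrySet := (Finset.univ : Finset s).toList.map f
      have hUs : ∀ U, U ∈ Us ↔ ∃ v, f v = U := by simp [Us]
      have hbl : ∀ v w, (f v).Body w → W.level w < n := fun v w hb =>
        v.2.2.1 ▸ W.under_level _ _ (under_of_body hC hb)
      have hstep : C.IsMultiStep Us := by
        refine ⟨?_, ?_, ?_⟩
        · obtain ⟨v, hv⟩ := hsne
          exact List.ne_nil_of_mem ((hUs (f ⟨v, hv⟩)).2 ⟨_, rfl⟩)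
        · intro U hU
          obtain ⟨v, rfl⟩ := (hUs U).1 hU
          refine isLoop_subchart hC hT hrest _ (fun τ ht he => ?_) _ _
          exact v.2.2.1 ▸ hlev τ ht he
        · refine List.pairwise_map.2 ((Finset.nodup_toList _).imp fun {v w} hne => ⟨?_, ?_, ?_⟩)
          · refine Set.disjoint_left.2 fun τ hτ hτ' => hne (Subtype.ext ?_)
            exact hτ.2.1.symm.trans hτ'.2.1
          · exact fun hb => (hbl _ _ hb).ne v.2.2.1
          · exact fun hb => (hbl _ _ hb).ne w.2.2.1
      have hsub : entriesOf Us ⊆ W.entry := by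
        rintro τ ⟨U, hU, hτ⟩
        obtain ⟨v, rfl⟩ := (hUs U).1 hU
        exact hτ.2.2
      obtain ⟨Ts, hrun, hTs⟩ := ih (n + 1) (C.remove (entriesOf Us)) (B ∪ bodiesOf Us)
        (fun v hv => by
          have := hk v (mem_verts_of_mem_remove hv)
          omega)
        (fun τ hτ => hC hτ.1.1) (fun v hv => hT hv.1)
        (fun v hv l w ht he =>
          ⟨⟨hrest v (mem_verts_of_mem_remove hv) l w ht he, fun h => he (hsub h)⟩, hv⟩)
        (fun τ hτ he => hlev' τ hτ.1.1 he fun hv => hτ.1.2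
          ⟨f ⟨τ.1, hv⟩, (hUs _).2 ⟨_, rfl⟩, hτ.1.1, rfl, he⟩)
        (by
          rintro v (hv | ⟨U, hU, hv⟩)
          · exact (hB v hv).trans n.lt_succ_self
          · obtain ⟨u, rfl⟩ := (hUs U).1 hU
            exact (hbl _ _ hv).trans n.lt_succ_self)
      refine ⟨_, .step Us hstep ?_ hrun, ?_⟩
      · intro U hU hv
        obtain ⟨v, rfl⟩ := (hUs U).1 hU
        exact (hB _ hv).ne v.2.2.1
      · intro T hT
        rcases List.mem_cons.1 hT with rfl | hT
        · exact hsub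
        · exact hTs T hT

end LayeredWitness

theorem LayeredRun.subset_trans {C : OneChart A V} {B : Set V} {Ts : List (Set (Transition A V))}
    (h : LayeredRun C B Ts) : ∀ T ∈ Ts, T ⊆ C.trans := by
  induction h with
  | done => simp
  | step Us _ _ _ ih =>
    intro T hT
    rcases List.mem_cons.1 hT with rfl | hT
    · rintro τ ⟨U, _, hτ⟩
      exact U.entries_subset hτ
    · exact fun τ hτ => (ih T hT hτ).1.1

theorem LayeredRun.pairwise_disjoint {C : OneChart A V} {B : Set V}
    {Ts : List (Set (Transition A V))} (h : LayeredRun C B Ts) : Ts.Pairwise Disjoint := by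
  induction h with
  | done => exact .nil
  | step Us _ _ hrun ih =>
    refine List.pairwise_cons.2 ⟨fun T hT => Set.disjoint_left.2 fun τ hτ hτ' => ?_, ih⟩
    exact (hrun.subset_trans T hT hτ').1.2 hτ

theorem isGuardedLLEE_of_layeredRun {C : OneChart A V} {Ts : List (Set (Transition A V))}
    (h : LayeredRun C ∅ Ts) (hTs : ∀ T ∈ Ts, ∀ τ ∈ T, τ.2.1 ≠ none) : C.IsGuardedLLEE := by
  classical
  have huniq : ∀ (τ : Transition A V) (i j : ℕ) (T T' : Set (Transition A V)),
      Ts[i]? = some T → τ ∈ T → Ts[j]? = some T' → τ ∈ T' → i = j := by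
    intro τ i j T T' hi hτ hj hτ'
    obtain ⟨hi', rfl⟩ := List.getElem?_eq_some_iff.1 hi
    obtain ⟨hj', rfl⟩ := List.getElem?_eq_some_iff.1 hj
    have hp := List.pairwise_iff_getElem.1 h.pairwise_disjoint
    rcases lt_trichotomy i j with hij | hij | hij
    · exact (Set.disjoint_left.1 (hp i j hi' hj' hij) hτ hτ').elim
    · exact hij
    · exact (Set.disjoint_left.1 (hp j i hj' hi' hij) hτ' hτ).elim
  let P : Transition A V → ℕ → Prop := fun τ n => ∃ T, Ts[n]? = some T ∧ τ ∈ T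
  let m : Transition A V → ℕ := fun τ => if h : ∃ n, P τ n then h.choose + 1 else 0
  refine ⟨m, ⟨Ts, h, fun τ _ n => ?_⟩, fun τ _ hm => ?_⟩
  · by_cases hP : ∃ n, P τ n
    · have hm : m τ = hP.choose + 1 := dif_pos hP
      obtain ⟨T, hT, hτ⟩ := hP.choose_spec
      rw [hm, Nat.add_right_cancel_iff]
      constructor
      · rintro rfl
        exact ⟨T, hT, hτ⟩
      · rintro ⟨T', hT', hτ'⟩
        exact huniq τ _ _ T T' hT hτ hT' hτ'
    · have hm : m τ = 0 := dif_neg hP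
      rw [hm]
      exact ⟨fun h => by omega, fun h => (hP ⟨n, h⟩).elim⟩
  · by_cases hP : ∃ n, P τ n
    · obtain ⟨n, T, hT, hτ⟩ := hP
      exact hTs T (List.mem_of_getElem? hT) τ hτ
    · exact (hm (dif_neg hP)).elim

theorem LayeredWitness.isGuardedLLEE {C : OneChart A V} (W : C.LayeredWitness) :
    C.IsGuardedLLEE := by
  obtain ⟨k, hk⟩ := (C.finite_verts.image W.level).bddAbove
  obtain ⟨Ts, hrun, hTs⟩ := W.exists_layeredRun (k + 1) 0 C ∅
    (fun v hv => by
      have := hk (Set.mem_image_of_mem W.level hv)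
      omega)
    subset_rfl subset_rfl (fun _ _ _ _ h _ => h) (fun _ _ _ => Nat.zero_le _) (by simp)
  exact isGuardedLLEE_of_layeredRun hrun fun T hT τ hτ =>
    W.proper τ (hrun.subset_trans T hT hτ) (hTs T hT hτ)

end OneChart

/-! ### Transitions between lists of star expressions -/

namespace StExp

/-- A measure of star expressions: derivatives of an expression that is not an iteration have a
smaller total measure, and derivatives of `e` consist of expressions of smaller measure
than `e*`. -/
def size : StExp A → ℕ
  | zero => 1
  | one => 1
  | act _ => 1
  | add e f => 2 * (e.size + f.size)
  | mul e f => 2 * (e.size + f.size)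
  | star e => 2 * e.size

theorem size_pos (e : StExp A) : 0 < e.size := by
  induction e <;> simp only [size] <;> omega

end StExp

/-- The sum of the sizes of the expressions in a list. -/
def weight (L : List (StExp A)) : ℕ := (L.map StExp.size).sum

@[simp]
theorem weight_nil : weight ([] : List (StExp A)) = 0 := rfl

@[simp]
theorem weight_cons (e : StExp A) (L : List (StExp A)) : weight (e :: L) = e.size + weight L := by
  simp [weight]

@[simp]
theorem weight_append (L K : List (StExp A)) : weight (L ++ K) = weight L + weight K := by
  simp [weight]

namespace StExp

theorem weight_lt_of_mem_der {e : StExp A} {p : A × List (StExp A)} (hp : p ∈ e.der) :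
    weight p.2 < 2 * e.size ∧ ((∀ f, e ≠ star f) → weight p.2 < e.size) := by
  induction e generalizing p with
  | zero => simp [der] at hp
  | one => simp [der] at hp
  | act a =>
    rw [der, List.mem_singleton] at hp
    subst hp
    simp [size]
  | add e f ihe ihf =>
    rw [size]
    rcases List.mem_append.1 hp with hp | hp
    · have := (ihe hp).1
      exact ⟨by omega, fun _ => by omega⟩
    · have := (ihf hp).1
      exact ⟨by omega, fun _ => by omega⟩
  | mul e f ihe ihf =>
    rw [size]
    have hf := f.size_pos
    rcases List.mem_append.1 hp with hp | hp
    · obtain ⟨q, hq, rfl⟩ := List.mem_map.1 hp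
      have := (ihe hq).1
      simp only [weight_append, weight_cons, weight_nil]
      exact ⟨by omega, fun _ => by omega⟩
    · split_ifs at hp
      · have := (ihf hp).1
        exact ⟨by omega, fun _ => by omega⟩
      · simp at hp
  | star e ih =>
    refine ⟨?_, fun h => (h e rfl).elim⟩
    obtain ⟨q, hq, rfl⟩ := List.mem_map.1 hp
    have := (ih hq).1
    split_ifs
    · simp only [weight_append, weight_cons, weight_nil, size]
      omega
    · simp only [size]
      omega

theorem size_le_of_mem_der {e : StExp A} {p : A × List (StExp A)} (hp : p ∈ e.der) {x : StExp A}
    (hx : x ∈ p.2) : x.size ≤ e.size := by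
  induction e generalizing p with
  | zero => simp [der] at hp
  | one => simp [der] at hp
  | act a =>
    rw [der, List.mem_singleton] at hp
    subst hp
    simp at hx
  | add e f ihe ihf =>
    rw [size]
    rcases List.mem_append.1 hp with hp | hp
    · have := ihe hp hx
      omega
    · have := ihf hp hx
      omega
  | mul e f ihe ihf =>
    rw [size]
    rcases List.mem_append.1 hp with hp | hp
    · obtain ⟨q, hq, rfl⟩ := List.mem_map.1 hp
      rcases List.mem_append.1 hx with hx | hx
      · have := ihe hq hx
        omega
      · rw [List.mem_singleton.1 hx]
        omega
    · split_ifs at hp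
      · have := ihf hp hx
        omega
      · simp at hp
  | star e ih =>
    obtain ⟨q, hq, rfl⟩ := List.mem_map.1 hp
    dsimp only at hx
    rw [size]
    split_ifs at hx
    · rcases List.mem_append.1 hx with hx | hx
      · have := ih hq hx
        omega
      · rw [List.mem_singleton.1 hx, size]
    · have := ih hq hx
      omega

end StExp

open Classical in
/-- The transitions from a list `[e₁, …, eₙ]` of star expressions, understood as the product
`e₁ · (⋯ · eₙ)`: the first expression performs an action, or it terminates and is removed by a
`1`-transition. -/
noncomputable def outs : List (StExp A) → List (Option A × List (StExp A))
  | [] => []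
  | e :: K => (if e.Terminates then [(none, K)] else []) ++
      e.der.map fun p => (some p.1, p.2 ++ K)

theorem mem_outs_cons {e : StExp A} {K L : List (StExp A)} {l : Option A} :
    (l, L) ∈ outs (e :: K) ↔ (l = none ∧ L = K ∧ e.Terminates) ∨
      ∃ a M, l = some a ∧ L = M ++ K ∧ (a, M) ∈ e.der := by
  rw [outs, List.mem_append]
  refine or_congr ?_ ?_
  · split_ifs with h <;> simp [h]
  · simp only [List.mem_map, Prod.mk.injEq, Prod.exists]
    constructor
    · rintro ⟨a, M, h, rfl, rfl⟩
      exact ⟨a, M, rfl, rfl, h⟩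
    · rintro ⟨a, M, rfl, rfl, h⟩
      exact ⟨a, M, h, rfl, rfl⟩

theorem mem_outs_append {L K L' : List (StExp A)} {l : Option A} (hL : L ≠ [])
    (h : (l, L') ∈ outs (L ++ K)) : ∃ M, L' = M ++ K ∧ (l, M) ∈ outs L := by
  obtain ⟨e, L, rfl⟩ := List.exists_cons_of_ne_nil hL
  rcases mem_outs_cons.1 h with ⟨rfl, rfl, he⟩ | ⟨a, M, rfl, rfl, hM⟩
  · exact ⟨L, rfl, mem_outs_cons.2 (Or.inl ⟨rfl, rfl, he⟩)⟩
  · exact ⟨M ++ L, by simp, mem_outs_cons.2 (Or.inr ⟨a, M, rfl, rfl, hM⟩)⟩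

theorem size_lt_of_mem_outs {n : ℕ} {L L' : List (StExp A)} {l : Option A}
    (hL : ∀ x ∈ L, x.size < n) (h : (l, L') ∈ outs L) : ∀ x ∈ L', x.size < n := by
  cases L with
  | nil => simp [outs] at h
  | cons e L =>
    rw [List.forall_mem_cons] at hL
    rcases mem_outs_cons.1 h with ⟨rfl, rfl, he⟩ | ⟨a, M, rfl, rfl, hM⟩
    · exact hL.2
    · intro x hx
      rcases List.mem_append.1 hx with hx | hx
      · exact (StExp.size_le_of_mem_der hM hx).trans_lt hL.1
      · exact hL.2 x hx

/-- A transition from a list of star expressions decreases the weight, unless it is an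
action transition from some `e* :: K` that re-creates `e* :: K` at the end of the target. -/
theorem weight_lt_or_of_mem_outs {L L' : List (StExp A)} {l : Option A} (h : (l, L') ∈ outs L) :
    weight L' < weight L ∨ l ≠ none ∧ ∃ e K M, L = .star e :: K ∧ L' = M ++ L ∧
      (∀ x ∈ M, x.Normed) ∧ ∀ x ∈ M, x.size < (StExp.star e).size := by
  cases L with
  | nil => simp [outs] at h
  | cons e K =>
    rcases mem_outs_cons.1 h with ⟨rfl, rfl, he⟩ | ⟨a, M, rfl, rfl, hM⟩
    · refine Or.inl ?_
      have := e.size_pos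
      rw [weight_cons]
      omega
    · by_cases hs : ∀ f, e ≠ .star f
      · refine Or.inl ?_
        have := (StExp.weight_lt_of_mem_der hM).2 hs
        rw [weight_append, weight_cons]
        dsimp only at this
        omega
      · push Not at hs
        obtain ⟨f, rfl⟩ := hs
        obtain ⟨⟨b, N⟩, hN, heq⟩ := List.mem_map.1 hM
        rw [Prod.mk.injEq] at heq
        obtain ⟨rfl, rfl⟩ := heq
        dsimp only
        split_ifs with hn
        · refine Or.inr ⟨by simp, f, K, N, rfl, by simp, hn, fun x hx => ?_⟩
          have := StExp.size_le_of_mem_der hN hx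
          have := f.size_pos
          rw [StExp.size]
          omega
        · refine Or.inl ?_
          have := (StExp.weight_lt_of_mem_der hN).1
          rw [weight_append, weight_cons, StExp.size]
          dsimp only at this
          omega

namespace StExp

/-- A finite set of lists that contains all lists that are reachable from `[e]`. -/
def reach : StExp A → Set (List (StExp A))
  | zero => {[zero], []}
  | one => {[one], []}
  | act a => {[act a], []}
  | add e f => {[add e f]} ∪ (e.reach ∪ f.reach)
  | mul e f => {[mul e f]} ∪ ((· ++ [f]) '' e.reach ∪ f.reach)
  | star e => {[star e], []} ∪ ((· ++ [star e]) '' e.reach ∪ e.reach)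

theorem finite_reach (e : StExp A) : e.reach.Finite := by
  induction e with
  | zero => simp [reach]
  | one => simp [reach]
  | act a => simp [reach]
  | add e f ihe ihf => exact (Set.finite_singleton _).union (ihe.union ihf)
  | mul e f ihe ihf => exact (Set.finite_singleton _).union ((ihe.image _).union ihf)
  | star e ih => exact (Set.toFinite {[star e], []}).union ((ih.image _).union ih)

theorem nil_mem_reach (e : StExp A) : [] ∈ e.reach := by
  induction e with
  | zero => simp [reach]
  | one => simp [reach]
  | act a => simp [reach]
  | add e f ihe ihf => exact Or.inr (Or.inl ihe)
  | mul e f ihe ihf => exact Or.inr (Or.inr ihf)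
  | star e ih => exact Or.inr (Or.inr ih)

theorem singleton_mem_reach (e : StExp A) : [e] ∈ e.reach := by
  cases e <;> simp [reach]

theorem mem_reach_of_mem_outs_singleton {e : StExp A} (hd : ∀ p ∈ e.der, p.2 ∈ e.reach)
    {L : List (StExp A)} {l : Option A} (h : (l, L) ∈ outs [e]) : L ∈ e.reach := by
  rcases mem_outs_cons.1 h with ⟨-, rfl, -⟩ | ⟨a, M, -, rfl, hM⟩
  · exact nil_mem_reach e
  · simpa using hd _ hM

theorem mem_reach_of_mem_der {e : StExp A} {p : A × List (StExp A)} (hp : p ∈ e.der) :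
    p.2 ∈ e.reach := by
  induction e generalizing p with
  | zero => simp [der] at hp
  | one => simp [der] at hp
  | act a =>
    rw [der, List.mem_singleton] at hp
    subst hp
    simp [reach]
  | add e f ihe ihf =>
    rcases List.mem_append.1 hp with hp | hp
    · exact Or.inr (Or.inl (ihe hp))
    · exact Or.inr (Or.inr (ihf hp))
  | mul e f ihe ihf =>
    rcases List.mem_append.1 hp with hp | hp
    · obtain ⟨q, hq, rfl⟩ := List.mem_map.1 hp
      exact Or.inr (Or.inl ⟨_, ihe hq, rfl⟩)
    · split_ifs at hp
      · exact Or.inr (Or.inr (ihf hp))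
      · simp at hp
  | star e ih =>
    obtain ⟨q, hq, rfl⟩ := List.mem_map.1 hp
    dsimp only
    split_ifs
    · exact Or.inr (Or.inl ⟨_, ih hq, rfl⟩)
    · exact Or.inr (Or.inr (ih hq))

theorem mem_reach_of_mem_outs {e : StExp A} {L L' : List (StExp A)} {l : Option A}
    (hL : L ∈ e.reach) (h : (l, L') ∈ outs L) : L' ∈ e.reach := by
  induction e generalizing L L' l with
  | zero | one | act =>
    rcases hL with rfl | rfl
    · exact mem_reach_of_mem_outs_singleton (fun _ => mem_reach_of_mem_der) h
    · simp [outs] at h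
  | add e f ihe ihf =>
    rcases hL with rfl | hL | hL
    · exact mem_reach_of_mem_outs_singleton (fun _ => mem_reach_of_mem_der) h
    · exact Or.inr (Or.inl (ihe hL h))
    · exact Or.inr (Or.inr (ihf hL h))
  | mul e f ihe ihf =>
    rcases hL with rfl | ⟨L, hL, rfl⟩ | hL
    · exact mem_reach_of_mem_outs_singleton (fun _ => mem_reach_of_mem_der) h
    · by_cases hn : L = []
      · subst hn
        exact Or.inr (Or.inr (ihf (singleton_mem_reach f) h))
      · obtain ⟨M, rfl, hM⟩ := mem_outs_append hn h
        exact Or.inr (Or.inl ⟨M, ihe hL hM, rfl⟩)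
    · exact Or.inr (Or.inr (ihf hL h))
  | star e ih =>
    rcases hL with (rfl | rfl) | ⟨L, hL, rfl⟩ | hL
    · exact mem_reach_of_mem_outs_singleton (fun _ => mem_reach_of_mem_der) h
    · simp [outs] at h
    · by_cases hn : L = []
      · subst hn
        exact mem_reach_of_mem_outs_singleton (fun _ => mem_reach_of_mem_der) h
      · obtain ⟨M, rfl, hM⟩ := mem_outs_append hn h
        exact Or.inr (Or.inl ⟨M, ih hL hM, rfl⟩)
    · exact Or.inr (Or.inr (ih hL h))

end StExp

/-! ### 1-charts of lists of star expressions -/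

theorem length_lt_of_mem_outs_none {L L' : List (StExp A)} (h : (none, L') ∈ outs L) :
    L'.length < L.length := by
  cases L with
  | nil => simp [outs] at h
  | cons e K =>
    rcases mem_outs_cons.1 h with ⟨-, rfl, -⟩ | ⟨a, M, ha, -⟩
    · simp
    · simp at ha

section ListChart

variable {V : Type} [Finite V] (lab : V → List (StExp A))

/-- The 1-chart with vertices `V`, where `v` stands for the list `lab v` of star expressions. Only
vertices that stand for the empty list terminate immediately. -/
def listChart (v₀ : V) : OneChart A V where
  verts := Set.univ
  finite_verts := Set.finite_univ
  start := v₀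
  start_mem := trivial
  trans := {τ | (τ.2.1, lab τ.2.2) ∈ outs (lab τ.1)}
  trans_mem _ _ := ⟨trivial, trivial⟩
  term := {v | lab v = []}
  term_subset _ _ := trivial

theorem weaklyGuarded_listChart (v₀ : V) : (listChart lab v₀).WeaklyGuarded := by
  intro v hv
  have : ∀ w, Relation.TransGen (fun x y => (x, none, y) ∈ (listChart lab v₀).trans) v w →
      (lab w).length < (lab v).length := by
    intro w h
    induction h with
    | single h => exact length_lt_of_mem_outs_none h
    | tail _ h ih => exact (length_lt_of_mem_outs_none h).trans ih
  exact (this v hv).false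

variable {lab}

/-- The loop-entry transitions are the action transitions from lists `e* :: K` after which `e* :: K`
is still at the end of the list. The body of the loop is contained in the set of lists `M ++ e* :: K`
with `M` nonempty and consisting of expressions of smaller size than `e*`. -/
def listChartWitness (hinj : Function.Injective lab)
    (hclosed : ∀ v l L, (l, L) ∈ outs (lab v) → ∃ w, lab w = L) (v₀ : V) :
    (listChart lab v₀).LayeredWitness where
  entry := {τ | lab τ.1 <:+ lab τ.2.2}
  level v := ((lab v).head?.map StExp.size).getD 0
  weight v := weight (lab v)
  Under v w := ∃ M, M ≠ [] ∧ lab w = M ++ lab v ∧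
    ∀ x ∈ M, x.size < ((lab v).head?.map StExp.size).getD 0
  Returns v w := ∃ M, M ≠ [] ∧ lab w = M ++ lab v ∧ ∀ x ∈ M, x.Normed
  proper := by
    rintro ⟨v, l, w⟩ ht ⟨M, hM⟩
    rcases weight_lt_or_of_mem_outs ht with h | h
    · dsimp only at h hM
      rw [← hM, weight_append] at h
      omega
    · exact h.1
  weight_lt := by
    intro v l w ht he
    rcases weight_lt_or_of_mem_outs ht with h | ⟨-, e, K, M, -, h, -⟩
    · exact h
    · exact (he ⟨M, h.symm⟩).elim
  entry_under := by
    rintro v l w ht ⟨M, hM⟩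
    rcases weight_lt_or_of_mem_outs ht with h | ⟨-, e, K, N, hv, hw, hn, hs⟩
    · dsimp only at h hM
      rw [← hM, weight_append] at h
      omega
    · by_cases hN : N = []
      · subst hN
        exact Or.inl (hinj hw)
      · refine Or.inr ⟨⟨N, hN, hw, fun x hx => ?_⟩, N, hN, hw, hn⟩
        dsimp only at hv
        rw [hv]
        exact hs x hx
  step_under := by
    rintro v w l w' ⟨M, hM, hw, hs⟩ ht
    have ht : (l, lab w') ∈ outs (lab w) := ht
    rw [hw] at ht
    obtain ⟨N, hN, hout⟩ := mem_outs_append hM ht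
    by_cases hN0 : N = []
    · subst hN0
      exact Or.inl (hinj hN)
    · exact Or.inr ⟨N, hN0, hN, size_lt_of_mem_outs hs hout⟩
  under_level := by
    rintro v w ⟨M, hM, hw, hs⟩
    obtain ⟨x, M, rfl⟩ := List.exists_cons_of_ne_nil hM
    simpa [hw] using hs x (by simp)
  under_term := by
    rintro v w ⟨M, hM, hw, -⟩ h
    have h : lab w = [] := h
    rw [hw] at h
    exact hM (List.append_eq_nil_iff.1 h).1
  step_returns := by
    rintro v w ⟨M, hM, hw, hn⟩
    obtain ⟨e, M, rfl⟩ := List.exists_cons_of_ne_nil hM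
    rw [List.forall_mem_cons] at hn
    rw [List.cons_append] at hw
    -- Either `e` is removed, or it is replaced by a normed derivative of smaller weight.
    have key : ∃ l N, (l, N ++ lab v) ∈ outs (lab w) ∧ (∀ x ∈ N, x.Normed) ∧
        weight (N ++ lab v) < weight (lab w) := by
      by_cases he : e.Terminates
      · refine ⟨none, M, ?_, hn.2, ?_⟩
        · rw [hw]
          exact mem_outs_cons.2 (Or.inl ⟨rfl, rfl, he⟩)
        · have := e.size_pos
          rw [hw, weight_cons]
          omega
      · obtain ⟨p, hp, hpn⟩ := hn.1.terminates_or_exists_der.resolve_left he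
        refine ⟨some p.1, p.2 ++ M, ?_, fun x hx => ?_, ?_⟩
        · rw [hw]
          exact mem_outs_cons.2 (Or.inr ⟨p.1, p.2, rfl, by simp, hp⟩)
        · exact (List.mem_append.1 hx).elim (hpn x) (hn.2 x)
        · have := (StExp.weight_lt_of_mem_der hp).2 fun f hf => he (hf ▸ .star)
          rw [hw, weight_cons]
          simp only [weight_append]
          omega
    obtain ⟨l, N, hout, hN, hlt⟩ := key
    obtain ⟨w', hw'⟩ := hclosed w l _ hout
    refine ⟨l, w', ?_, ?_, ?_⟩
    · show (l, lab w') ∈ outs (lab w)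
      rwa [hw']
    · rintro ⟨K, hK⟩
      dsimp only at hK
      rw [← hw', ← hK, weight_append] at hlt
      omega
    · by_cases hN0 : N = []
      · subst hN0
        exact Or.inl (hinj hw')
      · exact Or.inr ⟨N, hN0, hw', hN⟩

variable {Γ : Set (Equation A)}

open Classical in
theorem isSolution_listChart (hinj : Function.Injective lab)
    (hclosed : ∀ v l L, (l, L) ∈ outs (lab v) → ∃ w, lab w = L) (v₀ : V)
    (σ : List (StExp A) → ProvQuot Γ)
    (hσ : ∀ v, σ (lab v) = (if lab v = [] then 1 else 0) +
      ((outs (lab v)).map fun p => mk Γ (OneChart.labelExp p.1) * σ p.2).sum)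
    (s : V → StExp A) (hs : ∀ v, mk Γ (s v) = σ (lab v)) :
    (listChart lab v₀).IsSolution ((milMinus A).addAxioms Γ) s := by
  intro v _
  have : Nonempty V := ⟨v₀⟩
  have hinv : ∀ p ∈ outs (lab v), lab (Function.invFun lab p.2) = p.2 := fun p hp =>
    Function.invFun_eq (hclosed v p.1 p.2 hp)
  refine ⟨(outs (lab v)).map fun p => (p.1, Function.invFun lab p.2), fun a w => ?_, ?_⟩
  · rw [List.mem_map]
    constructor
    · rintro ⟨p, hp, heq⟩
      rw [Prod.mk.injEq] at heq
      obtain ⟨rfl, rfl⟩ := heq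
      show (p.1, lab _) ∈ outs (lab v)
      rwa [hinv p hp]
    · intro h
      exact ⟨(a, lab w), h, by rw [Function.leftInverse_invFun hinj w]⟩
  · rw [← mk_eq_mk, hs, hσ, mk_add, mk_sum, List.map_map, List.map_map]
    congr 1
    · by_cases h : lab v = [] <;> simp [OneChart.termConst, listChart, h, mk_one, mk_zero]
    · congr 1
      refine List.map_congr_left fun p hp => ?_
      simp only [Function.comp_apply, mk_mul, hs, hinv p hp]

end ListChart

/-! ### The 1-chart for an instance of the fixed-point rule -/

section Fixpoint

variable {Γ : Set (Equation A)}

theorem sum_outs_cons {e : StExp A} {K : List (StExp A)} (σ : List (StExp A) → ProvQuot Γ)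
    (x : ProvQuot Γ) (hK : e.Terminates → σ K = x)
    (hd : ∀ p ∈ e.der, σ (p.2 ++ K) = prod Γ p.2 * x) :
    ((outs (e :: K)).map fun p => mk Γ (OneChart.labelExp p.1) * σ p.2).sum = mk Γ e * x := by
  classical
  rw [mk_mul_eq, outs, List.map_append, List.sum_append, List.map_map]
  congr 1
  · split_ifs with h
    · simp [OneChart.labelExp, mk_one, hK h]
    · simp
  · congr 1
    refine List.map_congr_left fun p hp => ?_
    simp only [Function.comp_apply, OneChart.labelExp, hd p hp]

open Classical in
theorem prod_eq_sum_outs (L : List (StExp A)) : prod Γ L = (if L = [] then 1 else 0) +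
    ((outs L).map fun p => mk Γ (OneChart.labelExp p.1) * prod Γ p.2).sum := by
  cases L with
  | nil => simp [outs]
  | cons e K => rw [sum_outs_cons _ (prod Γ K) (fun _ => rfl) (by simp)]; simp

open Classical in
/-- The product of the classes of the expressions in a list, where the list `T` at the end is
interpreted as `c` instead of as a product. -/
noncomputable def prodTail (T : List (StExp A)) (c : ProvQuot Γ) (L : List (StExp A)) :
    ProvQuot Γ :=
  if h : T <:+ L then prod Γ h.choose * c else prod Γ L

theorem prodTail_append (T : List (StExp A)) (c : ProvQuot Γ) (L : List (StExp A)) :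
    prodTail T c (L ++ T) = prod Γ L * c := by
  have h : T <:+ L ++ T := ⟨L, rfl⟩
  rw [prodTail, dif_pos h, List.append_cancel_right h.choose_spec]

theorem prodTail_of_not_suffix {T : List (StExp A)} (c : ProvQuot Γ) {L : List (StExp A)}
    (h : ¬ T <:+ L) : prodTail T c L = prod Γ L :=
  dif_neg h

/-- The list `[f*, g · 1]`. The factor `1` makes this list recognizable at the end of a list: the
expression `g · 1` does not occur in lists that are reached by transitions from `[g · 1]`. -/
def startList (f g : StExp A) : List (StExp A) := [.star f, .mul g .one]

/-- The lists that are reached from `[f*, g · 1]` after `f*` has been left. -/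
def Exited (f g : StExp A) (L : List (StExp A)) : Prop :=
  (∃ M, L = M ++ [.mul g .one] ∧ ∀ x ∈ M, x.size < (StExp.star f).size) ∨
    ∀ x ∈ L, x.size < (StExp.mul g .one).size

variable {f g : StExp A}

theorem Exited.not_suffix {L : List (StExp A)} (h : Exited f g L) : ¬ startList f g <:+ L := by
  rintro ⟨K, rfl⟩
  rcases h with ⟨M, hM, hs⟩ | h
  · have : K ++ [StExp.star f] = M := by
      refine List.append_cancel_right (bs := [.mul g .one]) ?_
      rw [← hM, startList]
      simp
    subst this
    exact (hs (.star f) (by simp)).false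
  · exact (h (.mul g .one) (by simp [startList])).false

theorem Exited.step {L L' : List (StExp A)} {l : Option A} (h : Exited f g L)
    (hs : (l, L') ∈ outs L) : Exited f g L' := by
  rcases h with ⟨M, rfl, hM⟩ | h
  · by_cases hM0 : M = []
    · subst hM0
      rcases mem_outs_cons.1 hs with ⟨-, rfl, -⟩ | ⟨a, M, -, rfl, hM⟩
      · exact Or.inr (by simp)
      · refine Or.inr fun x hx => ?_
        rw [List.append_nil] at hx
        have hg := g.size_pos
        rcases List.mem_append.1 hM with hM | hM
        · obtain ⟨q, hq, heq⟩ := List.mem_map.1 hM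
          rw [Prod.mk.injEq] at heq
          obtain ⟨-, rfl⟩ := heq
          rcases List.mem_append.1 hx with hx | hx
          · have := StExp.size_le_of_mem_der hq hx
            simp only [StExp.size]
            omega
          · rw [List.mem_singleton.1 hx]
            simp only [StExp.size]
            omega
        · simp [StExp.der] at hM
    · obtain ⟨N, rfl, hN⟩ := mem_outs_append hM0 hs
      exact Or.inl ⟨N, rfl, size_lt_of_mem_outs hM hN⟩
  · exact Or.inr (size_lt_of_mem_outs h hs)

theorem exited_append_of_mem_der {p : A × List (StExp A)} (hp : p ∈ f.der) :
    Exited f g (p.2 ++ [.mul g .one]) := by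
  refine Or.inl ⟨_, rfl, fun x hx => ?_⟩
  have := StExp.size_le_of_mem_der hp hx
  have := f.size_pos
  rw [StExp.size]
  omega

theorem suffix_or_exited_step {L L' : List (StExp A)} {l : Option A}
    (h : startList f g <:+ L ∨ Exited f g L) (hs : (l, L') ∈ outs L) :
    startList f g <:+ L' ∨ Exited f g L' := by
  rcases h with ⟨K, rfl⟩ | h
  · by_cases hK : K = []
    · subst hK
      rcases mem_outs_cons.1 hs with ⟨-, rfl, -⟩ | ⟨a, M, -, rfl, hM⟩
      · exact Or.inr (Or.inl ⟨[], rfl, by simp⟩)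
      · obtain ⟨q, hq, heq⟩ := List.mem_map.1 hM
        rw [Prod.mk.injEq] at heq
        obtain ⟨-, rfl⟩ := heq
        split_ifs
        · exact Or.inl ⟨q.2, by simp [startList]⟩
        · exact Or.inr (exited_append_of_mem_der hq)
    · obtain ⟨N, rfl, -⟩ := mem_outs_append hK hs
      exact Or.inl ⟨N, rfl⟩
  · exact Or.inr (h.step hs)

open Classical in
/-- If `c = f · c + g` and `f` does not permit immediate termination, then a solution arises from
interpreting the list `[f*, g · 1]` as `c`. Lists `M ++ [g · 1]` with `M` an unnormed derivative
of `f` do not end with `[f*, g · 1]`; they are harmless because `prod M` absorbs what follows it. -/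
theorem prodTail_eq_sum_outs (hf : ¬ f.Terminates) {c : ProvQuot Γ}
    (hc : c = mk Γ f * c + mk Γ g) {L : List (StExp A)}
    (h : startList f g <:+ L ∨ Exited f g L) :
    prodTail (startList f g) c L = (if L = [] then 1 else 0) +
      ((outs L).map fun p => mk Γ (OneChart.labelExp p.1) * prodTail (startList f g) c p.2).sum := by
  rcases h with ⟨K, rfl⟩ | h
  · cases K with
    | cons e K =>
      rw [prodTail_append, if_neg (by simp), zero_add, List.cons_append,
        sum_outs_cons _ (prod Γ K * c) fun _ => prodTail_append _ _ _]
      · rw [prod_cons, mul_assoc]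
      · intro p _
        rw [← List.append_assoc, prodTail_append, prod_append, mul_assoc]
    | nil =>
      have hg : prodTail (startList f g) c [.mul g .one] = mk Γ g := by
        have hex : Exited f g [.mul g .one] := Or.inl ⟨[], rfl, by simp⟩
        rw [prodTail_of_not_suffix _ hex.not_suffix]
        simp [mk_mul, mk_one]
      have hd : ∀ p ∈ f.der, prodTail (startList f g) c
          ((if ∀ x ∈ p.2, x.Normed then p.2 ++ [.star f] else p.2) ++ [.mul g .one]) =
          prod Γ p.2 * c := by
        intro p hp
        split_ifs with hn
        · rw [List.append_assoc]
          exact prodTail_append _ _ _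
        · rw [prodTail_of_not_suffix _ (exited_append_of_mem_der hp).not_suffix, prod_append,
            prod_mul_of_not_normed hn, prod_mul_of_not_normed hn]
      have hfc := mk_mul_eq f c
      rw [if_neg hf, zero_add] at hfc
      have houts : outs (startList f g) = (none, [.mul g .one]) :: f.der.map fun p => (some p.1,
          (if ∀ x ∈ p.2, x.Normed then p.2 ++ [.star f] else p.2) ++ [.mul g .one]) := by
        simp [startList, outs, StExp.Terminates.star, StExp.der]
      rw [prodTail_append, prod_nil, one_mul, List.nil_append, if_neg (by simp [startList]),
        zero_add, houts, List.map_cons, List.sum_cons, List.map_map, hg, OneChart.labelExp, mk_one,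
        one_mul]
      conv_lhs => rw [hc, hfc, add_comm]
      congr 2
      refine List.map_congr_left fun p hp => ?_
      simp only [Function.comp_apply, OneChart.labelExp, hd p hp]
  · rw [prodTail_of_not_suffix _ h.not_suffix, prod_eq_sum_outs]
    congr 2
    refine List.map_congr_left fun p hp => ?_
    rw [prodTail_of_not_suffix _ (h.step hp).not_suffix]

theorem lleeCoindProvable_of_fixpoint {e : StExp A} (hf : ¬ f.Terminates)
    (he : ((milMinus A).addAxioms Γ).Derivable e (.add (.mul f e) g)) :
    LLEECoindProvable ((milMinus A).addAxioms Γ) ⟨e, .mul (.star f) g⟩ := by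
  let R : Set (List (StExp A)) :=
    {L | Relation.ReflTransGen (fun L L' => ∃ l, (l, L') ∈ outs L) (startList f g) L}
  have hfin : R.Finite := by
    refine (StExp.finite_reach (.mul (.star f) (.mul g .one))).subset fun L hL => ?_
    induction hL with
    | refl => exact Or.inr (Or.inl ⟨[.star f], StExp.singleton_mem_reach _, rfl⟩)
    | tail _ h ih => exact StExp.mem_reach_of_mem_outs ih h.choose_spec
  have hR : ∀ L ∈ R, startList f g <:+ L ∨ Exited f g L := by
    intro L hL
    induction hL with
    | refl => exact Or.inl List.suffix_rfl
    | tail _ h ih => exact suffix_or_exited_step ih h.choose_spec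
  have := hfin.to_subtype
  -- Vertices of 1-charts come from types in `Type`, whatever the universe of `A`.
  obtain ⟨n, ⟨φ⟩⟩ := Finite.exists_equiv_fin R
  let lab : Fin n → List (StExp A) := fun i => (φ.symm i).1
  have hinj : Function.Injective lab := Subtype.val_injective.comp φ.symm.injective
  have hclosed : ∀ v l L, (l, L) ∈ outs (lab v) → ∃ w, lab w = L := fun v l L h =>
    ⟨φ ⟨L, (φ.symm v).2.tail ⟨l, h⟩⟩, by simp [lab]⟩
  let v₀ : Fin n := φ ⟨startList f g, .refl⟩
  have hv₀ : lab v₀ = startList f g := by simp [lab, v₀]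
  have hc : mk Γ e = mk Γ f * mk Γ e + mk Γ g := mk_eq_mk.2 he
  choose out hout using exists_mk_eq (Γ := Γ)
  refine ⟨Fin n, ⟨listChart lab v₀, weaklyGuarded_listChart lab v₀,
    fun v => if v = v₀ then ⟨e, .mul (.star f) g⟩ else
      ⟨out (prodTail (startList f g) (mk Γ e) (lab v)), out (prod Γ (lab v))⟩,
    ?_, ?_, if_pos rfl⟩, (listChartWitness hinj hclosed v₀).isGuardedLLEE⟩
  · refine isSolution_listChart hinj hclosed v₀ (prodTail (startList f g) (mk Γ e))
      (fun v => prodTail_eq_sum_outs hf hc (hR _ (φ.symm v).2)) _ fun v => ?_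
    split_ifs with h
    · rw [h, hv₀]
      simpa using (prodTail_append (startList f g) (mk Γ e) []).symm
    · exact hout _
  · refine isSolution_listChart hinj hclosed v₀ (prod Γ) (fun v => prod_eq_sum_outs _) _
      fun v => ?_
    split_ifs with h
    · rw [h, hv₀, startList]
      simp [mk_mul, mk_one]
    · exact hout _

end Fixpoint

theorem rspStarRule_subset_lcoProofRule : rspStarRule A ⊆ lcoProofRule A 1 := by
  rintro ⟨_, _⟩ ⟨e, f, g, hf⟩
  exact ⟨rfl, lleeCoindProvable_of_fixpoint hf (derivable_addAxioms _ (by simp))⟩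

/-! ### The proof transformation -/

theorem ProofTree.concl_replaceRSPStar (D : ProofTree A) : D.replaceRSPStar.concl = D.concl := by
  cases D <;> rfl

theorem ProofTree.IsDerivation.replaceRSPStar {Δ : Set (Equation A)} {D : ProofTree A}
    (h : D.IsDerivation (mil A) Δ) : D.replaceRSPStar.IsDerivation (cMilOne A) Δ := by
  induction D with
  | assm E => exact h
  | ax E => exact h
  | node r n sub E ih =>
    refine ⟨fun i => ih i (h.1 i), ?_⟩
    simp only [ProofTree.concl_replaceRSPStar]
    rcases h.2 with hr | ⟨rfl, hr⟩
    · cases r with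
      | rspStar => nomatch hr
      | lcoProof => nomatch hr
      | _ => exact Or.inl hr
    · exact Or.inr ⟨rfl, rspStarRule_subset_lcoProofRule hr⟩

/-- On words, the proof transformation replaces the symbol for the rule `RSP*` by the symbol for
the rule `LCoProof_1`. -/
def replaceSymb (s : Symb) : Symb := if s = (3, 4) then (3, 6) else s

theorem computable_map_replaceSymb : Computable (List.map replaceSymb) := by
  refine Primrec.to_comp
    (Primrec.list_map Primrec.id (Primrec.comp (f := replaceSymb) ?_ Primrec.snd))
  exact Primrec.ite (Primrec.eq.comp Primrec.id (Primrec.const _)) (Primrec.const _) Primrec.id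

theorem StExp.map_replaceSymb_word (ν : A → ℕ) (e : StExp A) :
    (e.word ν).map replaceSymb = e.word ν := by
  induction e <;> simp_all [StExp.word, replaceSymb]

theorem Equation.map_replaceSymb_word (ν : A → ℕ) (E : Equation A) :
    (E.word ν).map replaceSymb = E.word ν := by
  simp [Equation.word, StExp.map_replaceSymb_word]

theorem RuleName.replaceSymb_number (r : RuleName) :
    replaceSymb (3, r.number) = (3, r.replaceRSPStar.number) := by
  cases r <;> simp [replaceSymb, RuleName.number, RuleName.replaceRSPStar]

theorem ProofTree.map_replaceSymb_word (ν : A → ℕ) (D : ProofTree A) :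
    (D.word ν).map replaceSymb = D.replaceRSPStar.word ν := by
  induction D with
  | assm E =>
    simp [ProofTree.word, ProofTree.replaceRSPStar, Equation.map_replaceSymb_word, replaceSymb]
  | ax E =>
    simp [ProofTree.word, ProofTree.replaceRSPStar, Equation.map_replaceSymb_word, replaceSymb]
  | node r n sub E ih =>
    have h4 : replaceSymb (4, n) = (4, n) := by simp [replaceSymb]
    simp only [ProofTree.word, ProofTree.replaceRSPStar, List.map_cons, List.map_append,
      Equation.map_replaceSymb_word, RuleName.replaceSymb_number, h4, List.map_flatten,
      List.map_ofFn, Function.comp_def, ih]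

theorem effective_replaceRSPStar : Effective (A := A) ProofTree.replaceRSPStar :=
  ⟨_, computable_map_replaceSymb, fun ν D => D.map_replaceSymb_word ν⟩

end Milner

theorem mainTheorem3 (A : Type*) :
    -- every theorem of Mil is a theorem of cMil₁
    (Milner.mil A).ThmSubsumedBy (Milner.cMilOne A) ∧
    -- every inference of RSP* is an inference of LCoProof_1
    Milner.rspStarRule A ⊆ Milner.lcoProofRule A 1 ∧
    -- replacing instances of RSP* by instances of LCoProof_1 with the same premise and conclusion
    -- transforms derivations in Mil into derivations in cMil₁ with the same conclusion ...
    (∀ (Δ : Set (Milner.Equation A)) (D : Milner.ProofTree A),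
      D.IsDerivation (Milner.mil A) Δ →
        D.replaceRSPStar.IsDerivation (Milner.cMilOne A) Δ ∧ D.replaceRSPStar.concl = D.concl) ∧
    -- ... and is an effective operation
    Milner.Effective (A := A) Milner.ProofTree.replaceRSPStar := by
  refine ⟨?_, Milner.rspStarRule_subset_lcoProofRule,
    fun Δ D h => ⟨h.replaceRSPStar, D.concl_replaceRSPStar⟩, Milner.effective_replaceRSPStar⟩
  rintro e f ⟨D, hD, hc⟩
  exact ⟨D.replaceRSPStar, hD.replaceRSPStar, D.concl_replaceRSPStar.trans hc⟩
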